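/- Let $S$ and $A$ be Borel spaces (Borel subsets of complete separable metric spaces), $K\subset S\times A$ a closed set whose sections $A(s)=\{a:(s,a)\in K\}$ are all nonempty, $Q(\cdot\mid s,a)$ a stochastic kernel from $K$ to $S$, $r,z:K\to\mathbb R$ measurable, $\delta\in(0,1)$, $\nu$ a probability measure on $S$, and $Y$ a random variable with values in $[a,b]$ almost surely. Write $(x)_-=\min\{x,0\}$, $y(\eta)=\mathbb E[(Y-\eta)_-]$, $w=1-r$, $\hat w(s)=1-\sup_{a\in A(s)}r(s,a)$. Let $\mathcal M_w(K)$ be the space of signed measures $\mu$ on $K$ with $\int w\,d|\mu|<\infty$, let $\mathcal F_w(K)$ be the space of measurable $f:K\to\mathbb R$ with $\sup_K|f|/w<\infty$, let $\mathcal F_{\hat w}(S)$ be the space of measurable $h:S\to\mathbb R$ with $\|h\|_{\hat w}=\sup_S|h|/\hat w<\infty$, and let $\mathcal M([a,b])$ be the space of finite signed Borel measures on $[a,b]$. For $\mu\ge0$ in $\mathcal M_w(K)$, with marginal $\hat\mu$ on $S$, put $$[L_0\mu](B)=\hat\mu(B)-\delta\int_K Q(B\mid s,a)\,\mu(d(s,a)),\qquad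 [L_1\mu](\eta)=\int_K(z-\eta)_-\,d\mu,$$ and put $$[L_0^*h](s,a)=h(s)-\delta\int_S h(\xi)\,Q(d\xi\mid s,a),\qquad [L_1^*\Lambda](s,a)=\int_a^b(z(s,a)-\eta)_-\,\Lambda(d\eta).$$ The primal problem (P) is $$\max\ \langle\mu,r\rangle\quad\text{s.t. } L_0\mu=\nu,\quad L_1\mu\ge y\text{ on }[a,b],\quad \mu\in\mathcal M_w(K),\ \mu\ge0 .$$ Assume: (P) has a feasible point; $r\le0$ and $\{(s,a)\in K: r(s,a)\ge-\epsilon\}$ is compact for every $\epsilon\ge0$; $z$ is bounded and upper semicontinuous; $Q$ is weakly continuous, i.e. $(s,a)\mapsto\int f\,dQ(\cdot\mid s,a)$ is continuous for every bounded continuous $f$ on $S$; and $(s,a)\mapsto\int\hat w(\xi)\,Q(d\xi\mid s,a)$ is finite and belongs to $\mathcal F_w(K)$. Then: 1. The Lagrangian dual of (P) is the problem (D) $$\min\ \langle h,\nu\rangle-\langle\Lambda,y\rangle\quad\text{s.t. } r+L_1^*\Lambda\le L_0^*h\text{ on }K,\quad h\in\mathcal F_{\hat w}(S),\ \Lambda\in\mathcal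 M([a,b]),\ \Lambda\ge0 .$$ That is, for the Lagrangian $\vartheta(\mu,h,\Lambda)=\langle\mu,r\rangle+\langle h,L_0\mu-\nu\rangle+\langle\Lambda,L_1\mu-y\rangle$ and all $h\in\mathcal F_{\hat w}(S)$ and $0\le\Lambda\in\mathcal M([a,b])$, the supremum of $\vartheta(\mu,-h,\Lambda)$ over $0\le\mu\in\mathcal M_w(K)$ equals $\langle h,\nu\rangle-\langle\Lambda,y\rangle$ if $r+L_1^*\Lambda\le L_0^*h$ on $K$, and $+\infty$ otherwise. 2. The optimal values of (P) and (D) are finite and equal, and the maximum in (P) is attained. 3. If (D) has a minimizing sequence $(h_n,\Lambda_n)$ with $(h_n)$ bounded in $\|\cdot\|_{\hat w}$ and $(\Lambda_n)$ weak* bounded, then (D) is solvable, i.e. its minimum is attained. -/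

import Mathlib

open MeasureTheory ProbabilityTheory Filter Topology
open scoped ENNReal

namespace DominanceMDP

noncomputable section

/-- Data of a discounted Markov decision process with a stochastic dominance constraint.
The state space `S` and the action space `A` are Borel spaces; `K` is the set of feasible
state-action pairs, so that `A(s) = {a | (s, a) ∈ K}`. -/
structure Model (S A Ω : Type*) [TopologicalSpace S] [MeasurableSpace S]
    [TopologicalSpace A] [MeasurableSpace A] [MeasurableSpace Ω] where
  /-- feasible state-action pairs -/
  K : Set (S × A)
  K_closed : IsClosed K
  /-- every state has a feasible action -/
  K_nonempty : ∀ s, ∃ a, (s, a) ∈ K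
  /-- transition law -/
  Q : Kernel K S
  Q_markov : IsMarkovKernel Q
  /-- reward -/
  r : K → ℝ
  r_measurable : Measurable r
  /-- the reward whose shortfalls are constrained -/
  z : K → ℝ
  z_measurable : Measurable z
  /-- discount factor -/
  δ : ℝ
  δ_pos : 0 < δ
  δ_lt_one : δ < 1
  /-- initial distribution -/
  ν : Measure S
  ν_prob : IsProbabilityMeasure ν
  /-- endpoints of the interval that carries the benchmark -/
  a : ℝ
  b : ℝ
  /-- law on the sample space of the benchmark -/
  P : Measure Ω
  P_prob : IsProbabilityMeasure P
  /-- benchmark random variable -/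
  Y : Ω → ℝ
  Y_measurable : Measurable Y
  Y_mem : ∀ᵐ ω ∂P, Y ω ∈ Set.Icc a b

attribute [instance] Model.Q_markov Model.ν_prob Model.P_prob

/-- `(x)_- = min {x, 0}`. -/
def negPart (x : ℝ) : ℝ := min x 0

namespace Model

variable {S A Ω : Type*} [TopologicalSpace S] [MeasurableSpace S]
  [TopologicalSpace A] [MeasurableSpace A] [MeasurableSpace Ω]

/-- The index set `[a, b]` of shortfall levels. -/
abbrev Levels (M : Model S A Ω) : Type := Set.Icc M.a M.b

/-- The weight `w = 1 - r` on `K`. -/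
def w (M : Model S A Ω) (k : M.K) : ℝ := 1 - M.r k

/-- The weight `ŵ(s) = 1 - sup_{a ∈ A(s)} r(s, a)` on `S`. -/
def wHat (M : Model S A Ω) (s : S) : ℝ := 1 - ⨆ a : {a : A // (s, a) ∈ M.K}, M.r ⟨(s, a), a.2⟩

/-- The positive cone of `M_w(K)`: finite positive measures `μ` on `K` with `∫ w dμ < ∞`. -/
def MwPos (M : Model S A Ω) : Set (FiniteMeasure M.K) :=
  {μ | ∫⁻ k, ENNReal.ofReal (M.w k) ∂(μ : Measure M.K) < ∞}

/-- `F_ŵ(S)`: measurable functions `h` on `S` with `sup_s |h(s)| / ŵ(s) < ∞`. -/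
def FwHat (M : Model S A Ω) : Set (S → ℝ) :=
  {h | Measurable h ∧ ∃ C : ℝ, ∀ s, |h s| ≤ C * M.wHat s}

/-- `L₀ μ`, the signed measure `B ↦ μ(B × A) - δ ∫ Q(B | s, a) μ(d(s, a))` on `S`. -/
def L0 (M : Model S A Ω) (μ : FiniteMeasure M.K) : SignedMeasure S :=
  ((μ : Measure M.K).map (fun k => k.1.1)).toSignedMeasure
    - M.δ • ((μ : Measure M.K).bind M.Q).toSignedMeasure

/-- `[L₁ μ](η) = ⟨μ, (z - η)_-⟩`. -/
def L1 (M : Model S A Ω) (μ : FiniteMeasure M.K) (η : ℝ) : ℝ :=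
  ∫ k, negPart (M.z k - η) ∂(μ : Measure M.K)

/-- `y(η) = E[(Y - η)_-]`. -/
def y (M : Model S A Ω) (η : ℝ) : ℝ := ∫ ω, negPart (M.Y ω - η) ∂M.P

/-- `[L₀* h](s, a) = h(s) - δ ∫ h(ξ) Q(dξ | s, a)`. -/
def L0adj (M : Model S A Ω) (h : S → ℝ) (k : M.K) : ℝ := h k.1.1 - M.δ * ∫ ξ, h ξ ∂(M.Q k)

/-- `[L₁* Λ](s, a) = ∫_a^b (z(s, a) - η)_- Λ(dη)`. -/
def L1adj (M : Model S A Ω) (Λ : FiniteMeasure M.Levels) (k : M.K) : ℝ :=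
  ∫ η : M.Levels, negPart (M.z k - η) ∂(Λ : Measure M.Levels)

/-- Objective of the primal problem. -/
def primalObj (M : Model S A Ω) (μ : FiniteMeasure M.K) : ℝ := ∫ k, M.r k ∂(μ : Measure M.K)

/-- Feasible set of the primal problem. -/
def primalFeasible (M : Model S A Ω) : Set (FiniteMeasure M.K) :=
  {μ | μ ∈ M.MwPos ∧ M.L0 μ = M.ν.toSignedMeasure ∧ ∀ η ∈ Set.Icc M.a M.b, M.y η ≤ M.L1 μ η}

/-- The Lagrangian `⟨μ, r⟩ + ⟨h, L₀ μ - ν⟩ + ⟨Λ, L₁ μ - y⟩`. -/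
def lagrangian (M : Model S A Ω) (μ : FiniteMeasure M.K) (h : S → ℝ)
    (Λ : FiniteMeasure M.Levels) : ℝ :=
  (∫ k, M.r k ∂(μ : Measure M.K))
    + VectorMeasure.integral (M.L0 μ - M.ν.toSignedMeasure) h (ContinuousLinearMap.lsmul ℝ ℝ).flip
    + ∫ η : M.Levels, (M.L1 μ η - M.y η) ∂(Λ : Measure M.Levels)

/-- The modified discounted Bellman inequality `r + L₁* Λ ≤ L₀* h` on `K`. -/
def BellmanIneq (M : Model S A Ω) (h : S → ℝ) (Λ : FiniteMeasure M.Levels) : Prop :=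
  ∀ k : M.K, M.r k + M.L1adj Λ k ≤ M.L0adj h k

/-- Objective `⟨h, ν⟩ - ⟨Λ, y⟩` of the dual problem. -/
def dualObj (M : Model S A Ω) (h : S → ℝ) (Λ : FiniteMeasure M.Levels) : ℝ :=
  (∫ s, h s ∂M.ν) - ∫ η : M.Levels, M.y η ∂(Λ : Measure M.Levels)

/-- Feasible set of the dual problem. -/
def dualFeasible (M : Model S A Ω) : Set ((S → ℝ) × FiniteMeasure M.Levels) :=
  {p | p.1 ∈ M.FwHat ∧ M.BellmanIneq p.1 p.2}

/-- Objective values of the primal problem over its feasible set. -/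
def primalValues (M : Model S A Ω) : Set ℝ := M.primalObj '' M.primalFeasible

/-- Objective values of the dual problem over its feasible set. -/
def dualValues (M : Model S A Ω) : Set ℝ := (fun p => M.dualObj p.1 p.2) '' M.dualFeasible

/-- Standing assumptions. -/
structure Standing (M : Model S A Ω) : Prop where
  /-- the constrained problem is consistent -/
  consistent : M.primalFeasible.Nonempty
  r_nonpos : ∀ k, M.r k ≤ 0
  r_compact : ∀ ε : ℝ, 0 ≤ ε → IsCompact {k : M.K | -ε ≤ M.r k}
  z_bounded : ∃ C : ℝ, ∀ k, |M.z k| ≤ C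
  z_usc : UpperSemicontinuous M.z
  /-- the transition law is weakly continuous -/
  Q_weak : ∀ f : BoundedContinuousFunction S ℝ, Continuous fun k => ∫ ξ, f ξ ∂(M.Q k)
  /-- `(s, a) ↦ ∫ ŵ(ξ) Q(dξ | s, a)` is finite and belongs to `F_w(K)` -/
  Q_weight : ∃ C : ℝ, ∀ k,
    ∫⁻ ξ, ENNReal.ofReal (M.wHat ξ) ∂(M.Q k) ≤ ENNReal.ofReal (C * M.w k)

/-- There is a minimizing sequence `(hₙ, Λₙ)` of the dual problem with `hₙ` bounded in the norm of
`F_ŵ(S)` and `Λₙ` bounded in the weak* topology of the dual space of `C([a, b])`. -/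
def HasBoundedMinimizingSequence (M : Model S A Ω) : Prop :=
  ∃ (h : ℕ → S → ℝ) (Λ : ℕ → FiniteMeasure M.Levels),
    (∀ n, (h n, Λ n) ∈ M.dualFeasible) ∧
    Tendsto (fun n => M.dualObj (h n) (Λ n)) atTop (𝓝 (sInf M.dualValues)) ∧
    (∃ C : ℝ, ∀ n s, |h n s| ≤ C * M.wHat s) ∧
    ∀ f : C(M.Levels, ℝ), ∃ C : ℝ, ∀ n, |∫ η, f η ∂(Λ n : Measure M.Levels)| ≤ C

end Model

end

end DominanceMDP

/-! For fixed multipliers the Lagrangian is affine in `μ`: the integral of the gap `r + L₁* Λ - L₀*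
h` plus the dual objective (`lagrangian_neg_eq`). Over a cone of measures containing all multiples
of Dirac masses, its supremum is therefore finite exactly when the gap is nonpositive everywhere.

Strong duality comes from compactness and a finite-dimensional separation. Testing `L₀ μ = ν` with
`h = 1` shows that feasible measures have mass `1 / (1 - δ)`, so the search is over probability
measures `p = (1 - δ) μ`. Let `v` bound the dual values from below. Each `β < v`, bounded continuous
`h` and `Λ ≥ 0` give a Lagrangian bound on `p`. It cuts out a weakly closed set, because the gap is
upper semicontinuous and bounded above; for `h = 0`, `Λ = 0` the set is even compact, by Prokhorov
and the compact superlevel sets of `r`. If finitely many bounds were incompatible, the theorem of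
the alternative would give a convex combination of multipliers which, after adding a constant to
`h`, is dual feasible with value below `v` (`exists_dualFeasible_lt`). So one `p` satisfies all the
bounds, and scaling the multipliers turns them into primal feasibility and value at least `v`
(`exists_primalFeasible_ge`).

A bounded minimizing sequence of the dual gives a minimizer made of a weak limit of the `Λₙ` and the
pointwise lower limit of the `hₙ`, since the Bellman inequality survives lower limits. -/

namespace DominanceMDP

noncomputable section

set_option linter.unusedSectionVars false

/-! ### Weak topology on probability measures, and a theorem of the alternative -/

section General

/-- Fatou's lemma for weak convergence: the integral of a nonnegative lower semicontinuous function
is lower semicontinuous in the probability measure. -/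
theorem isClosed_setOf_lintegral_le {X : Type*} [TopologicalSpace X]
    [TopologicalSpace.PseudoMetrizableSpace X] [TopologicalSpace.SeparableSpace X]
    [MeasurableSpace X] [BorelSpace X] {f : X → ℝ} (hf : LowerSemicontinuous f)
    (hf0 : ∀ x, 0 ≤ f x) (c : ℝ≥0∞) :
    IsClosed {p : ProbabilityMeasure X | ∫⁻ x, ENNReal.ofReal (f x) ∂(p : Measure X) ≤ c} := by
  have key : LowerSemicontinuous
      fun p : ProbabilityMeasure X => ∫⁻ x, ENNReal.ofReal (f x) ∂(p : Measure X) := by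
    intro p
    refine lowerSemicontinuousAt_iff_le_liminf.2 ?_
    -- Layer cake: the integral becomes one over `t` of the masses of the open sets `{t < f}`, where
    -- the portmanteau inequality applies for each `t`.
    simp_rw [lintegral_eq_lintegral_meas_lt _ (Eventually.of_forall hf0) hf.measurable.aemeasurable]
    refine (lintegral_mono fun t => ?_).trans
      (lintegral_liminf_le (u := 𝓝 p) fun q => Antitone.measurable fun s t hst =>
        measure_mono fun x hx => lt_of_le_of_lt hst hx)
    exact ProbabilityMeasure.le_liminf_measure_open_of_tendsto tendsto_id (hf.isOpen_preimage t)
  exact key.isClosed_preimage c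

/-- The Bochner integral of a nonintegrable function is `0` by convention, so integrability must be
stated on the left; on the right it is part of the bound. The sign of `c` matters because
`ENNReal.ofReal` truncates. -/
theorem integrable_and_integral_le_iff {X : Type*} [MeasurableSpace X] (p : Measure X) {f : X → ℝ}
    (hf : Measurable f) (hf0 : ∀ x, 0 ≤ f x) {c : ℝ} (hc : 0 ≤ c) :
    (Integrable f p ∧ ∫ x, f x ∂p ≤ c) ↔ ∫⁻ x, ENNReal.ofReal (f x) ∂p ≤ ENNReal.ofReal c := by
  constructor
  · rintro ⟨hi, hle⟩
    rw [← ofReal_integral_eq_lintegral_ofReal hi (Eventually.of_forall hf0)]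
    exact ENNReal.ofReal_le_ofReal hle
  · intro h
    have hi : Integrable f p :=
      ⟨hf.aestronglyMeasurable, (hasFiniteIntegral_iff_ofReal (Eventually.of_forall hf0)).2
        (h.trans_lt ENNReal.ofReal_lt_top)⟩
    refine ⟨hi, ?_⟩
    rw [← ofReal_integral_eq_lintegral_ofReal hi (Eventually.of_forall hf0)] at h
    exact (ENNReal.ofReal_le_ofReal_iff hc).1 h

/-- Superlevel sets of `p ↦ ∫ g dp` are weakly closed for upper semicontinuous `g` that are bounded
above. -/
theorem isClosed_setOf_le_integral {X : Type*} [TopologicalSpace X]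
    [TopologicalSpace.PseudoMetrizableSpace X] [TopologicalSpace.SeparableSpace X]
    [MeasurableSpace X] [BorelSpace X] {g : X → ℝ} (hg : UpperSemicontinuous g)
    {C : ℝ} (hC : ∀ x, g x ≤ C) (c : ℝ) :
    IsClosed {p : ProbabilityMeasure X |
      Integrable g (p : Measure X) ∧ c ≤ ∫ x, g x ∂(p : Measure X)} := by
  -- The maximum with `c` makes `D - c` nonnegative, so `ENNReal.ofReal (D - c)` loses nothing.
  set D := max C c
  have hD : ∀ x, 0 ≤ D - g x := fun x => sub_nonneg.2 ((hC x).trans (le_max_left _ _))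
  have hlsc : LowerSemicontinuous fun x => D - g x :=
    (continuous_const.sub continuous_id).comp_upperSemicontinuous_antitone
      hg (fun _ _ h => sub_le_sub_left h D)
  convert isClosed_setOf_lintegral_le hlsc hD (ENNReal.ofReal (D - c)) using 1
  ext p
  simp only [Set.mem_ofPred_eq]
  rw [← integrable_and_integral_le_iff _ hlsc.measurable hD (sub_nonneg.2 (le_max_right _ _))]
  constructor
  · rintro ⟨hi, hle⟩
    refine ⟨(integrable_const D).sub hi, ?_⟩
    rw [integral_sub (integrable_const D) hi, integral_const, probReal_univ, one_smul]
    linarith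
  · rintro ⟨hi, hle⟩
    have hi' : Integrable g (p : Measure X) := by
      refine ((integrable_const D).sub hi).congr (Eventually.of_forall fun x => ?_)
      simp
    refine ⟨hi', ?_⟩
    rw [integral_sub (integrable_const D) hi', integral_const, probReal_univ, one_smul] at hle
    linarith

/-- Superlevel sets of `p ↦ ∫ r dp` are weakly compact when `r ≤ 0` has compact superlevel sets. -/
theorem isCompact_setOf_le_integral {X : Type*} [TopologicalSpace X]
    [TopologicalSpace.MetrizableSpace X] [TopologicalSpace.SeparableSpace X]
    [MeasurableSpace X] [BorelSpace X] {r : X → ℝ} (hr : UpperSemicontinuous r)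
    (hr0 : ∀ x, r x ≤ 0) (hcomp : ∀ ε : ℝ, 0 ≤ ε → IsCompact {x | -ε ≤ r x}) (c : ℝ) :
    IsCompact {p : ProbabilityMeasure X |
      Integrable r (p : Measure X) ∧ c ≤ ∫ x, r x ∂(p : Measure X)} := by
  -- Markov's inequality bounds the mass outside the compact set `{-(n + 1) ≤ r}` by `|c| / (n +
  -- 1)`, which gives tightness.
  let u : ℕ → NNReal := fun n => Real.toNNReal (|c| / (n + 1))
  have hu : Tendsto u atTop (𝓝 0) := by
    have h : Tendsto (fun n : ℕ => |c| / ((n : ℝ) + 1)) atTop (𝓝 0) :=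
      tendsto_const_nhds.div_atTop (tendsto_natCast_atTop_atTop.atTop_add tendsto_const_nhds)
    simpa [u, Function.comp_def] using (continuous_real_toNNReal.tendsto 0).comp h
  have hK : IsCompact {p : ProbabilityMeasure X |
      ∀ n : ℕ, p {x | -((n : ℝ) + 1) ≤ r x}ᶜ ≤ u n} :=
    isCompact_setOfPred_probabilityMeasure_mass_eq_compl_isCompact_le hu
      (fun n => hcomp _ (by positivity))
      (Or.inr fun m n hmn x hx => by
        have : (m : ℝ) ≤ n := by exact_mod_cast hmn
        simp only [Set.mem_ofPred_eq] at hx ⊢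
        linarith)
  refine hK.of_isClosed_subset (isClosed_setOf_le_integral hr hr0 c) ?_
  rintro p ⟨hi, hle⟩ n
  have hmk := mul_meas_ge_le_integral_of_nonneg (μ := (p : Measure X)) (f := fun x => -r x)
    (Eventually.of_forall fun x => neg_nonneg.2 (hr0 x)) hi.neg ((n : ℝ) + 1)
  rw [integral_neg] at hmk
  have hsub : (p : Measure X).real {x | -((n : ℝ) + 1) ≤ r x}ᶜ
      ≤ (p : Measure X).real {x | (n : ℝ) + 1 ≤ -r x} := by
    refine measureReal_mono fun x hx => ?_
    simp only [Set.mem_compl_iff, Set.mem_ofPred_eq, not_le] at hx ⊢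
    linarith
  have hn : (0 : ℝ) < n + 1 := by positivity
  have : (p : Measure X).real {x | -((n : ℝ) + 1) ≤ r x}ᶜ ≤ |c| / (n + 1) := by
    rw [le_div_iff₀ hn]
    nlinarith [neg_abs_le c]
  refine NNReal.coe_le_coe.1 ?_
  rw [Real.coe_toNNReal _ (by positivity)]
  exact this

/-- A theorem of the alternative: if no probability measure makes all the integrals of finitely many
functions nonnegative, then some convex combination of the functions is nonpositive. -/
theorem exists_weights_of_forall_exists_integral_neg {X ι : Type*} [MeasurableSpace X]
    [MeasurableSingletonClass X] [Nonempty X] [Fintype ι] {f : ι → X → ℝ}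
    (H : ∀ p : Measure X, IsProbabilityMeasure p → (∀ i, Integrable (f i) p) →
      ∃ i, ∫ x, f i x ∂p < 0) :
    ∃ l : ι → ℝ, (∀ i, 0 ≤ l i) ∧ ∑ i, l i = 1 ∧ ∀ x, ∑ i, l i * f i x ≤ 0 := by
  classical
  let C : Set (ι → ℝ) := {t | ∃ p : Measure X, IsProbabilityMeasure p ∧
    ∀ i, Integrable (f i) p ∧ t i = ∫ x, f i x ∂p}
  let U : Set (ι → ℝ) := Set.univ.pi fun _ => Set.Ioi 0
  have hU : IsOpen U := isOpen_set_pi Set.finite_univ fun _ _ => isOpen_Ioi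
  have hUc : Convex ℝ U := convex_pi fun _ _ => convex_Ioi 0
  have hC : Convex ℝ C := by
    rintro s ⟨p, hp, hs⟩ t ⟨q, hq, ht⟩ a b ha hb hab
    refine ⟨ENNReal.ofReal a • p + ENNReal.ofReal b • q, ⟨?_⟩, fun i => ⟨?_, ?_⟩⟩
    · simp [← ENNReal.ofReal_add ha hb, hab]
    · exact ((hs i).1.smul_measure ENNReal.ofReal_ne_top).add_measure
        ((ht i).1.smul_measure ENNReal.ofReal_ne_top)
    · rw [integral_add_measure ((hs i).1.smul_measure ENNReal.ofReal_ne_top)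
        ((ht i).1.smul_measure ENNReal.ofReal_ne_top), integral_smul_measure,
        integral_smul_measure, ENNReal.toReal_ofReal ha, ENNReal.toReal_ofReal hb]
      simp [(hs i).2, (ht i).2]
  have hdisj : Disjoint U C := by
    rw [Set.disjoint_left]
    rintro t ht ⟨p, hp, hpt⟩
    obtain ⟨i, hi⟩ := H p hp fun i => (hpt i).1
    have : 0 < t i := ht i trivial
    rw [(hpt i).2] at this
    exact lt_asymm this hi
  -- Separate the attainable moment vectors `C` from the open positive orthant `U`: `φ < c` on `U`
  -- and `c ≤ φ` on `C`. The weights will be the normalized `-φ (e i)`.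
  obtain ⟨φ, c, hφU, hφC⟩ := geometric_hahn_banach_open hUc hU hC hdisj
  let e : ι → (ι → ℝ) := fun i => Pi.single i 1
  have hφ : ∀ t : ι → ℝ, φ t = ∑ i, t i * φ (e i) := fun t => by
    conv_lhs => rw [pi_eq_sum_univ' t]
    simp [map_sum, e]
  have hc0 : 0 ≤ c := by
    have : Tendsto (fun ε : ℝ => φ (fun _ => ε)) (𝓝[>] 0) (𝓝 (φ fun _ => 0)) :=
      ((φ.continuous.comp (continuous_pi fun _ => continuous_id)).tendsto 0).mono_left
        nhdsWithin_le_nhds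
    have h0 : φ (fun _ : ι => (0 : ℝ)) = 0 := map_zero φ
    rw [h0] at this
    refine le_of_tendsto this ?_
    filter_upwards [self_mem_nhdsWithin] with ε hε
    exact (hφU _ fun _ _ => hε).le
  -- The orthant is unbounded in every direction `e i`, where `φ` must stay below `c`.
  have hle : ∀ i, φ (e i) ≤ 0 := by
    intro i
    by_contra! hpos
    obtain ⟨n, hn⟩ := exists_nat_gt ((c - φ fun _ => 1) / φ (e i))
    rw [div_lt_iff₀ hpos] at hn
    have := hφU ((fun _ => 1) + (n : ℝ) • e i) fun j _ => by
      have : (0 : ℝ) ≤ n * e i j :=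
        mul_nonneg n.cast_nonneg (by simp only [e, Pi.single_apply]; split_ifs <;> simp)
      simp only [Pi.add_apply, Pi.smul_apply, smul_eq_mul, Set.mem_Ioi]
      linarith
    rw [map_add, map_smul, smul_eq_mul] at this
    linarith
  -- Dirac masses turn the inequality on moment vectors into a pointwise one.
  have hx : ∀ x, 0 ≤ ∑ i, f i x * φ (e i) := fun x => by
    rw [← hφ fun i => f i x]
    exact hc0.trans (hφC _ ⟨Measure.dirac x, inferInstance, fun i =>
      ⟨integrable_dirac (by simp), by simp⟩⟩)
  -- If `φ` vanished, the separation would give both `0 < c` and `c ≤ 0`.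
  have hs : ∑ i, -φ (e i) ≠ 0 := by
    intro hs
    have hz : ∀ i, φ (e i) = 0 := fun i =>
      neg_eq_zero.1 ((Finset.sum_eq_zero_iff_of_nonneg fun i _ => neg_nonneg.2 (hle i)).1 hs i
        (Finset.mem_univ i))
    obtain ⟨x⟩ := ‹Nonempty X›
    have h1 := hφU (fun _ => 1) fun _ _ => Set.mem_Ioi.2 one_pos
    have h2 := hφC (fun i => f i x) ⟨Measure.dirac x, inferInstance, fun i =>
      ⟨integrable_dirac (by simp), by simp⟩⟩
    rw [hφ] at h1 h2
    simp only [hz, mul_zero, Finset.sum_const_zero] at h1 h2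
    exact lt_irrefl _ (h1.trans_le h2)
  have hs0 : 0 < ∑ i, -φ (e i) :=
    lt_of_le_of_ne (Finset.sum_nonneg fun i _ => neg_nonneg.2 (hle i)) hs.symm
  refine ⟨fun i => -φ (e i) / ∑ i, -φ (e i), fun i => div_nonneg (neg_nonneg.2 (hle i)) hs0.le,
    by rw [← Finset.sum_div, div_self hs], fun x => ?_⟩
  have : ∑ i, -φ (e i) / (∑ i, -φ (e i)) * f i x
      = -(∑ i, f i x * φ (e i)) / ∑ i, -φ (e i) := by
    rw [← Finset.sum_neg_distrib, Finset.sum_div]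
    exact Finset.sum_congr rfl fun i _ => by ring
  rw [this]
  exact div_nonpos_of_nonpos_of_nonneg (neg_nonpos.2 (hx x)) hs0.le

end General

theorem continuous_negPart : Continuous negPart := continuous_id.min continuous_const

theorem monotone_negPart : Monotone negPart := fun _ _ h => min_le_min_right 0 h

theorem negPart_nonpos (x : ℝ) : negPart x ≤ 0 := min_le_right _ _

theorem abs_negPart_le (x : ℝ) : |negPart x| ≤ |x| := by
  unfold negPart
  rcases le_total x 0 with h | h
  · rw [min_eq_left h]
  · rw [min_eq_right h, abs_zero]; exact abs_nonneg x

namespace Model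

/-! ### Weighted spaces, adjoint pairings and the Lagrangian dual function -/

section Weights

variable {S A Ω : Type*}
    [TopologicalSpace S] [TopologicalSpace.MetrizableSpace S] [SecondCountableTopology S]
    [MeasurableSpace S] [BorelSpace S]
    [TopologicalSpace A] [TopologicalSpace.MetrizableSpace A] [SecondCountableTopology A]
    [MeasurableSpace A] [BorelSpace A]
    [MeasurableSpace Ω]
    {M : Model S A Ω}

theorem Standing.r_usc (hM : M.Standing) : UpperSemicontinuous M.r := by
  rw [upperSemicontinuous_iff_isClosed_preimage]
  intro c
  rcases le_or_gt c 0 with hc | hc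
  · have := (hM.r_compact (-c) (neg_nonneg.2 hc)).isClosed
    rwa [neg_neg] at this
  · convert isClosed_empty
    ext k
    simpa using (hM.r_nonpos k).trans_lt hc

theorem Standing.bddAbove_r (hM : M.Standing) (s : S) :
    BddAbove (Set.range fun a : {a : A // (s, a) ∈ M.K} => M.r ⟨(s, a), a.2⟩) :=
  ⟨0, by rintro _ ⟨a, rfl⟩; exact hM.r_nonpos _⟩

theorem Standing.one_le_wHat (hM : M.Standing) (s : S) : 1 ≤ M.wHat s := by
  have : ⨆ a : {a : A // (s, a) ∈ M.K}, M.r ⟨(s, a), a.2⟩ ≤ 0 :=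
    Real.iSup_nonpos fun a => hM.r_nonpos _
  unfold wHat
  linarith

theorem Standing.wHat_le_w (hM : M.Standing) (k : M.K) : M.wHat k.1.1 ≤ M.w k :=
  sub_le_sub_left (le_ciSup (hM.bddAbove_r k.1.1) ⟨k.1.2, k.2⟩) 1

/-- A projection of a Borel set need not be Borel, but `{ŵ < c}` is a countable union of projections
of superlevel sets of `r`, which are compact. -/
theorem Standing.measurable_wHat (hM : M.Standing) : Measurable M.wHat := by
  refine measurable_of_Iio fun c => ?_
  have : M.wHat ⁻¹' Set.Iio c =
      ⋃ n : ℕ, (fun k : M.K => k.1.1) '' {k | 1 - c + 1 / ((n : ℝ) + 1) ≤ M.r k} := by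
    ext s
    have : Nonempty {a : A // (s, a) ∈ M.K} := let ⟨a, ha⟩ := M.K_nonempty s; ⟨⟨a, ha⟩⟩
    simp only [Set.mem_preimage, Set.mem_Iio, wHat, Set.mem_iUnion, Set.mem_image]
    rw [sub_lt_comm, lt_ciSup_iff (hM.bddAbove_r s)]
    constructor
    · rintro ⟨a, ha⟩
      obtain ⟨n, hn⟩ := exists_nat_one_div_lt (sub_pos.2 ha)
      exact ⟨n, ⟨(s, a), a.2⟩, by simp only [Set.mem_ofPred_eq]; linarith, rfl⟩
    · rintro ⟨n, k, hk, rfl⟩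
      have : (0 : ℝ) < 1 / ((n : ℝ) + 1) := by positivity
      simp only [Set.mem_ofPred_eq] at hk
      exact ⟨⟨k.1.2, k.2⟩, by simp only [Prod.mk.eta, Subtype.coe_eta]; linarith⟩
  rw [this]
  refine MeasurableSet.iUnion fun n => IsCompact.measurableSet ?_
  refine IsCompact.image ?_ (continuous_fst.comp continuous_subtype_val)
  rcases le_or_gt (1 - c + 1 / ((n : ℝ) + 1)) 0 with h | h
  · have := hM.r_compact _ (neg_nonneg.2 h)
    rwa [neg_neg] at this
  · convert isCompact_empty
    ext k
    simpa using (hM.r_nonpos k).trans_lt h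

theorem Standing.mem_MwPos_iff (hM : M.Standing) {μ : FiniteMeasure M.K} :
    μ ∈ M.MwPos ↔ Integrable M.r (μ : Measure M.K) := by
  have hw : ∀ k, 0 ≤ M.w k := fun k => by
    have := hM.r_nonpos k
    unfold w; linarith
  have hm : Measurable M.w := measurable_const.sub M.r_measurable
  have h1 : μ ∈ M.MwPos ↔ Integrable M.w (μ : Measure M.K) :=
    ⟨fun h => ⟨hm.aestronglyMeasurable,
      (hasFiniteIntegral_iff_ofReal (Eventually.of_forall hw)).2 h⟩,
      fun h => (hasFiniteIntegral_iff_ofReal (Eventually.of_forall hw)).1 h.2⟩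
  rw [h1]
  refine ⟨fun h => ?_, fun h => (integrable_const 1).sub h⟩
  refine ((integrable_const 1).sub h).congr (Eventually.of_forall fun k => ?_)
  simp [w]

theorem Standing.exists_integral_wHat_le (hM : M.Standing) : ∃ C : ℝ, ∀ k,
    Integrable M.wHat (M.Q k) ∧ ∫ ξ, M.wHat ξ ∂(M.Q k) ≤ C * M.w k := by
  obtain ⟨C, hC⟩ := hM.Q_weight
  have hw0 : ∀ s, 0 ≤ M.wHat s := fun s => zero_le_one.trans (hM.one_le_wHat s)
  refine ⟨max C 0, fun k => ?_⟩
  have hw : 0 ≤ M.w k := (hw0 _).trans (hM.wHat_le_w k)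
  refine (integrable_and_integral_le_iff _ hM.measurable_wHat hw0
    (mul_nonneg (le_max_right _ _) hw)).2 ((hC k).trans (ENNReal.ofReal_le_ofReal ?_))
  exact mul_le_mul_of_nonneg_right (le_max_left _ _) hw

theorem Standing.integrable_wHat_fst (hM : M.Standing) {μ : FiniteMeasure M.K} (hμ : μ ∈ M.MwPos) :
    Integrable (fun k : M.K => M.wHat k.1.1) (μ : Measure M.K) := by
  refine Integrable.mono' ((integrable_const 1).sub (hM.mem_MwPos_iff.1 hμ))
    (hM.measurable_wHat.comp (measurable_fst.comp measurable_subtype_coe)).aestronglyMeasurable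
    (Eventually.of_forall fun k => ?_)
  rw [Real.norm_of_nonneg (zero_le_one.trans (hM.one_le_wHat _))]
  exact hM.wHat_le_w k

theorem Standing.integrable_wHat_bind (hM : M.Standing) {μ : FiniteMeasure M.K} (hμ : μ ∈ M.MwPos) :
    Integrable M.wHat ((μ : Measure M.K).bind M.Q) := by
  obtain ⟨C, hC⟩ := hM.exists_integral_wHat_le
  refine (Measure.integrable_comp_iff hM.measurable_wHat.aestronglyMeasurable).2
    ⟨Eventually.of_forall fun k => (hC k).1, ?_⟩
  refine Integrable.mono' (((integrable_const 1).sub (hM.mem_MwPos_iff.1 hμ)).const_mul C)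
    hM.measurable_wHat.stronglyMeasurable.norm.integral_kernel.aestronglyMeasurable
    (Eventually.of_forall fun k => ?_)
  rw [Real.norm_of_nonneg (integral_nonneg fun _ => norm_nonneg _)]
  have : ∀ ξ, ‖M.wHat ξ‖ = M.wHat ξ := fun ξ =>
    Real.norm_of_nonneg (zero_le_one.trans (hM.one_le_wHat ξ))
  simp_rw [this]
  exact (hC k).2

/-- The equation adds the nonnegative measure `δ μQ` to `ν` to obtain the marginal of `μ`. -/
theorem le_map_of_L0_eq {μ : FiniteMeasure M.K} (h : M.L0 μ = M.ν.toSignedMeasure) :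
    M.ν ≤ (μ : Measure M.K).map fun k => k.1.1 := by
  refine Measure.le_iff.2 fun B hB => ?_
  have hB' := congrArg (fun m : SignedMeasure S => m B) h
  simp only [L0, FunLike.coe_sub, FunLike.coe_smul, Pi.sub_apply, Pi.smul_apply,
    Measure.toSignedMeasure_apply_measurable hB, smul_eq_mul] at hB'
  have hd : 0 ≤ M.δ * ((μ : Measure M.K).bind M.Q).real B :=
    mul_nonneg M.δ_pos.le measureReal_nonneg
  rw [← ENNReal.toReal_le_toReal (measure_ne_top _ _) (measure_ne_top _ _)]
  change M.ν.real B ≤ Measure.real _ B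
  linarith

/-- Integrability of `ŵ` under `ν` is inherited from a feasible point: its marginal dominates `ν`.
-/
theorem Standing.integrable_wHat_nu (hM : M.Standing) : Integrable M.wHat M.ν := by
  obtain ⟨μ, hμ, hL, -⟩ := hM.consistent
  refine Integrable.mono_measure ?_ (le_map_of_L0_eq hL)
  exact (integrable_map_measure hM.measurable_wHat.aestronglyMeasurable
    (measurable_fst.comp measurable_subtype_coe).aemeasurable).2 (hM.integrable_wHat_fst hμ)

theorem integrable_of_mem_FwHat {h : S → ℝ} (hh : h ∈ M.FwHat) {m : Measure S}
    (hm : Integrable M.wHat m) : Integrable h m := by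
  obtain ⟨hmeas, C, hC⟩ := hh
  exact Integrable.mono' (hm.const_mul C) hmeas.aestronglyMeasurable (Eventually.of_forall hC)

theorem integrable_fst_of_mem_FwHat (hM : M.Standing) {h : S → ℝ} (hh : h ∈ M.FwHat)
    {μ : FiniteMeasure M.K} (hμ : μ ∈ M.MwPos) :
    Integrable (fun k : M.K => h k.1.1) (μ : Measure M.K) := by
  obtain ⟨hmeas, C, hC⟩ := hh
  exact Integrable.mono' ((hM.integrable_wHat_fst hμ).const_mul C)
    (hmeas.comp (measurable_fst.comp measurable_subtype_coe)).aestronglyMeasurable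
    (Eventually.of_forall fun k => hC _)

theorem integral_bind_of_mem_FwHat (hM : M.Standing) {h : S → ℝ} (hh : h ∈ M.FwHat)
    {μ : FiniteMeasure M.K} (hμ : μ ∈ M.MwPos) :
    Integrable (fun k => ∫ ξ, h ξ ∂(M.Q k)) (μ : Measure M.K) ∧
      ∫ k, ∫ ξ, h ξ ∂(M.Q k) ∂(μ : Measure M.K) = ∫ ξ, h ξ ∂((μ : Measure M.K).bind M.Q) := by
  have hi := integrable_of_mem_FwHat hh (hM.integrable_wHat_bind hμ)
  rw [Measure.comp_eq_comp_const_apply] at hi ⊢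
  have h1 := hi.integral_comp
  rw [Kernel.const_apply] at h1
  exact ⟨h1, by rw [Kernel.integral_comp hi, Kernel.const_apply]⟩

theorem integrable_L0adj (hM : M.Standing) {h : S → ℝ} (hh : h ∈ M.FwHat)
    {μ : FiniteMeasure M.K} (hμ : μ ∈ M.MwPos) : Integrable (M.L0adj h) (μ : Measure M.K) :=
  (integrable_fst_of_mem_FwHat hM hh hμ).sub ((integral_bind_of_mem_FwHat hM hh hμ).1.const_mul _)

theorem neg_mem_FwHat {h : S → ℝ} (hh : h ∈ M.FwHat) : -h ∈ M.FwHat := by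
  obtain ⟨hm, C, hC⟩ := hh
  exact ⟨hm.neg, C, fun s => by simpa using hC s⟩

/-- The pairing `⟨h, L₀ μ - ν⟩` in terms of the adjoint operator. -/
theorem integral_L0_sub (hM : M.Standing) {h : S → ℝ} (hh : h ∈ M.FwHat)
    {μ : FiniteMeasure M.K} (hμ : μ ∈ M.MwPos) :
    VectorMeasure.integral (M.L0 μ - M.ν.toSignedMeasure) h (ContinuousLinearMap.lsmul ℝ ℝ).flip
      = ∫ k, M.L0adj h k ∂(μ : Measure M.K) - ∫ s, h s ∂M.ν := by
  have hfst : Measurable fun k : M.K => k.1.1 := measurable_fst.comp measurable_subtype_coe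
  have i1 : Integrable h ((μ : Measure M.K).map fun k => k.1.1) :=
    (integrable_map_measure hh.1.aestronglyMeasurable hfst.aemeasurable).2
      (integrable_fst_of_mem_FwHat hM hh hμ)
  have i2 := integrable_of_mem_FwHat hh (hM.integrable_wHat_bind hμ)
  have i3 := integrable_of_mem_FwHat hh hM.integrable_wHat_nu
  have v1 : VectorMeasure.Integrable
      ((μ : Measure M.K).map fun k => k.1.1).toSignedMeasure h := by
    rwa [VectorMeasure.Integrable, Measure.variation_toSignedMeasure]
  have v2 : VectorMeasure.Integrable (M.δ • ((μ : Measure M.K).bind M.Q).toSignedMeasure) h := by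
    refine VectorMeasure.Integrable.smul_vectorMeasure ?_ _
    rwa [VectorMeasure.Integrable, Measure.variation_toSignedMeasure]
  have v3 : VectorMeasure.Integrable M.ν.toSignedMeasure h := by
    rwa [VectorMeasure.Integrable, Measure.variation_toSignedMeasure]
  rw [L0, VectorMeasure.integral_sub_vectorMeasure (v1.sub_vectorMeasure v2) v3,
    VectorMeasure.integral_sub_vectorMeasure v1 v2, VectorMeasure.integral_smul_vectorMeasure,
    VectorMeasure.integral_toSignedMeasure, VectorMeasure.integral_toSignedMeasure,
    VectorMeasure.integral_toSignedMeasure, integral_map hfst.aemeasurable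
    hh.1.aestronglyMeasurable, ← (integral_bind_of_mem_FwHat hM hh hμ).2]
  unfold L0adj
  rw [integral_sub (integrable_fst_of_mem_FwHat hM hh hμ)
    ((integral_bind_of_mem_FwHat hM hh hμ).1.const_mul _), integral_const_mul, smul_eq_mul]

theorem abs_level_le (η : M.Levels) : |(η : ℝ)| ≤ |M.a| + |M.b| := by
  have h := η.2
  have h1 := neg_abs_le M.a
  have h2 := le_abs_self M.b
  have h3 := abs_nonneg M.a
  have h4 := abs_nonneg M.b
  exact abs_le.2 ⟨by linarith [h.1], by linarith [h.2]⟩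

theorem Standing.exists_abs_shortfall_le (hM : M.Standing) :
    ∃ B : ℝ, ∀ k (η : M.Levels), |negPart (M.z k - η)| ≤ B := by
  obtain ⟨C, hC⟩ := hM.z_bounded
  exact ⟨C + (|M.a| + |M.b|), fun k η => (abs_negPart_le _).trans ((abs_sub _ _).trans
    (add_le_add (hC k) (abs_level_le η)))⟩

theorem integrable_shortfall_prod (hM : M.Standing) (μ : FiniteMeasure M.K)
    (Λ : FiniteMeasure M.Levels) :
    Integrable (fun x : M.K × M.Levels => negPart (M.z x.1 - x.2))
      ((μ : Measure M.K).prod (Λ : Measure M.Levels)) := by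
  obtain ⟨B, hB⟩ := hM.exists_abs_shortfall_le
  refine Integrable.of_bound (C := B) ?_ (Eventually.of_forall fun x => hB _ _)
  exact (continuous_negPart.measurable.comp ((M.z_measurable.comp measurable_fst).sub
    (measurable_subtype_coe.comp measurable_snd))).aestronglyMeasurable

theorem integrable_L1adj (hM : M.Standing) (μ : FiniteMeasure M.K) (Λ : FiniteMeasure M.Levels) :
    Integrable (M.L1adj Λ) (μ : Measure M.K) :=
  (integrable_shortfall_prod hM μ Λ).integral_prod_left

theorem integrable_L1 (hM : M.Standing) (μ : FiniteMeasure M.K) (Λ : FiniteMeasure M.Levels) :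
    Integrable (fun η : M.Levels => M.L1 μ η) (Λ : Measure M.Levels) :=
  (integrable_shortfall_prod hM μ Λ).integral_prod_right

theorem integral_L1 (hM : M.Standing) (μ : FiniteMeasure M.K) (Λ : FiniteMeasure M.Levels) :
    ∫ η : M.Levels, M.L1 μ η ∂(Λ : Measure M.Levels) = ∫ k, M.L1adj Λ k ∂(μ : Measure M.K) :=
  (integral_integral_swap (integrable_shortfall_prod hM μ Λ)).symm

theorem continuous_y : Continuous fun η : M.Levels => M.y η := by
  refine continuous_of_dominated (bound := fun _ => |M.a| + |M.b| + (|M.a| + |M.b|)) (fun η =>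
    (continuous_negPart.measurable.comp (M.Y_measurable.sub_const _)).aestronglyMeasurable)
    (fun η => ?_) (integrable_const _) (Eventually.of_forall fun ω =>
      continuous_negPart.comp (continuous_const.sub continuous_subtype_val))
  filter_upwards [M.Y_mem] with ω hω
  exact (abs_negPart_le _).trans ((abs_sub _ _).trans
    (add_le_add (abs_level_le ⟨_, hω⟩) (abs_level_le η)))

theorem integrable_continuous_levels {f : M.Levels → ℝ} (hf : Continuous f)
    (Λ : FiniteMeasure M.Levels) : Integrable f (Λ : Measure M.Levels) :=
  (BoundedContinuousFunction.mkOfCompact ⟨f, hf⟩).integrable _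

/-- The gap `r + L₁* Λ - L₀* h` of the Bellman inequality. -/
def bellmanGap (M : Model S A Ω) (h : S → ℝ) (Λ : FiniteMeasure M.Levels) (k : M.K) : ℝ :=
  M.r k + M.L1adj Λ k - M.L0adj h k

theorem bellmanIneq_iff {h : S → ℝ} {Λ : FiniteMeasure M.Levels} :
    M.BellmanIneq h Λ ↔ ∀ k, M.bellmanGap h Λ k ≤ 0 :=
  forall_congr' fun _ => sub_nonpos.symm

theorem integral_bellmanGap (hM : M.Standing) {h : S → ℝ} (hh : h ∈ M.FwHat)
    (Λ : FiniteMeasure M.Levels) {μ : FiniteMeasure M.K} (hμ : μ ∈ M.MwPos) :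
    ∫ k, M.bellmanGap h Λ k ∂(μ : Measure M.K) = ∫ k, M.r k ∂(μ : Measure M.K)
      + ∫ k, M.L1adj Λ k ∂(μ : Measure M.K) - ∫ k, M.L0adj h k ∂(μ : Measure M.K) := by
  have h1 := integral_sub ((hM.mem_MwPos_iff.1 hμ).add (integrable_L1adj hM μ Λ))
    (integrable_L0adj hM hh hμ)
  simp only [Pi.add_apply] at h1
  unfold bellmanGap
  rw [h1, integral_add (hM.mem_MwPos_iff.1 hμ) (integrable_L1adj hM μ Λ)]

theorem L0adj_neg (h : S → ℝ) (k : M.K) : M.L0adj (-h) k = -M.L0adj h k := by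
  simp only [L0adj, Pi.neg_apply, integral_neg]
  ring

/-- The adjoint identities collect all terms in `μ` into one integral of the gap; both cases of the
dual function follow from its sign. -/
theorem lagrangian_neg_eq (hM : M.Standing) {h : S → ℝ} (hh : h ∈ M.FwHat)
    (Λ : FiniteMeasure M.Levels) {μ : FiniteMeasure M.K} (hμ : μ ∈ M.MwPos) :
    M.lagrangian μ (-h) Λ = ∫ k, M.bellmanGap h Λ k ∂(μ : Measure M.K) + M.dualObj h Λ := by
  rw [lagrangian, integral_L0_sub hM (neg_mem_FwHat hh) hμ, integral_bellmanGap hM hh Λ hμ,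
    integral_sub (integrable_L1 hM μ Λ) (integrable_continuous_levels continuous_y Λ),
    integral_L1 hM μ Λ, dualObj]
  simp only [L0adj_neg, Pi.neg_apply, integral_neg]
  ring

theorem iSup_lagrangian_of_bellmanIneq (hM : M.Standing) {h : S → ℝ} (hh : h ∈ M.FwHat)
    (Λ : FiniteMeasure M.Levels) (hB : M.BellmanIneq h Λ) :
    (⨆ μ ∈ M.MwPos, ((M.lagrangian μ (-h) Λ : ℝ) : EReal)) = ((M.dualObj h Λ : ℝ) : EReal) := by
  refine le_antisymm (iSup₂_le fun μ hμ => EReal.coe_le_coe_iff.2 ?_) ?_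
  · rw [lagrangian_neg_eq hM hh Λ hμ]
    have := integral_nonpos (μ := (μ : Measure M.K)) (bellmanIneq_iff.1 hB)
    linarith
  · have h0 : (0 : FiniteMeasure M.K) ∈ M.MwPos := hM.mem_MwPos_iff.2 (by simp)
    refine le_iSup₂_of_le 0 h0 (EReal.coe_le_coe_iff.2 ?_)
    rw [lagrangian_neg_eq hM hh Λ h0]
    simp

theorem iSup_lagrangian_of_not_bellmanIneq (hM : M.Standing) {h : S → ℝ} (hh : h ∈ M.FwHat)
    (Λ : FiniteMeasure M.Levels) (hB : ¬ M.BellmanIneq h Λ) :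
    (⨆ μ ∈ M.MwPos, ((M.lagrangian μ (-h) Λ : ℝ) : EReal)) = ⊤ := by
  rw [bellmanIneq_iff] at hB
  push Not at hB
  obtain ⟨k, hk⟩ := hB
  rw [EReal.eq_top_iff_forall_lt]
  intro c
  -- Mass `n` at a point violating the Bellman inequality pushes the Lagrangian above the given `c`.
  obtain ⟨n, hn⟩ := exists_nat_gt ((c - M.dualObj h Λ) / M.bellmanGap h Λ k)
  rw [div_lt_iff₀ hk] at hn
  let μ : FiniteMeasure M.K := (n : NNReal) • ⟨Measure.dirac k, inferInstance⟩
  have hμc : (μ : Measure M.K) = (n : NNReal) • Measure.dirac k := rfl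
  have hμ : μ ∈ M.MwPos := hM.mem_MwPos_iff.2 (by
    rw [hμc]
    exact (integrable_dirac (by simp)).smul_measure_nnreal)
  refine lt_of_lt_of_le (EReal.coe_lt_coe_iff.2 ?_) (le_iSup₂_of_le μ hμ le_rfl)
  rw [lagrangian_neg_eq hM hh Λ hμ, hμc, integral_smul_nnreal_measure, integral_dirac]
  simp only [NNReal.smul_def, NNReal.coe_natCast, smul_eq_mul]
  linarith

end Weights

end Model

namespace Model

/-! ### Strong duality and primal attainment -/

section Duality

open scoped BoundedContinuousFunction

variable {S A Ω : Type*}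
    [TopologicalSpace S] [TopologicalSpace.MetrizableSpace S] [SecondCountableTopology S]
    [MeasurableSpace S] [BorelSpace S]
    [TopologicalSpace A] [TopologicalSpace.MetrizableSpace A] [SecondCountableTopology A]
    [MeasurableSpace A] [BorelSpace A]
    [MeasurableSpace Ω]
    {M : Model S A Ω}

theorem Standing.mem_FwHat_of_bounded (hM : M.Standing) {h : S → ℝ} (hm : Measurable h) {C : ℝ}
    (hC : ∀ s, |h s| ≤ C) : h ∈ M.FwHat := by
  refine ⟨hm, C, fun s => (hC s).trans ?_⟩
  exact le_mul_of_one_le_right ((abs_nonneg _).trans (hC s)) (hM.one_le_wHat s)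

theorem Standing.bcf_mem_FwHat (hM : M.Standing) (h : S →ᵇ ℝ) : ⇑h ∈ M.FwHat :=
  hM.mem_FwHat_of_bounded h.continuous.measurable h.norm_coe_le_norm

theorem continuous_L0adj (hM : M.Standing) (h : S →ᵇ ℝ) : Continuous (M.L0adj h) :=
  (h.continuous.comp (continuous_fst.comp continuous_subtype_val)).sub
    (continuous_const.mul (hM.Q_weak h))

theorem continuous_shortfall_integral (Λ : FiniteMeasure M.Levels) :
    Continuous fun x : ℝ => ∫ η : M.Levels, negPart (x - η) ∂(Λ : Measure M.Levels) := by
  have := continuous_parametric_integral_of_continuous (μ := (Λ : Measure M.Levels))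
    (f := fun (x : ℝ) (η : M.Levels) => negPart (x - η))
    (continuous_negPart.comp (continuous_fst.sub (continuous_subtype_val.comp continuous_snd)))
    isCompact_univ
  simpa using this

/-- As `Λ` is nonnegative, the integrated shortfall is a nondecreasing as well as continuous
function of the value of `z`, and such functions preserve upper semicontinuity. -/
theorem upperSemicontinuous_L1adj (hM : M.Standing) (Λ : FiniteMeasure M.Levels) :
    UpperSemicontinuous (M.L1adj Λ) := by
  have hint : ∀ x : ℝ, Integrable (fun η : M.Levels => negPart (x - η)) (Λ : Measure M.Levels) :=
    fun x => integrable_continuous_levels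
      (continuous_negPart.comp (continuous_const.sub continuous_subtype_val)) Λ
  exact (continuous_shortfall_integral Λ).comp_upperSemicontinuous hM.z_usc fun x x' hx =>
    integral_mono (hint x) (hint x') fun η => monotone_negPart (sub_le_sub_right hx _)

theorem upperSemicontinuous_bellmanGap (hM : M.Standing) (h : S →ᵇ ℝ)
    (Λ : FiniteMeasure M.Levels) : UpperSemicontinuous (M.bellmanGap h Λ) := by
  have := (hM.r_usc.add (upperSemicontinuous_L1adj hM Λ)).add
    (continuous_L0adj hM h).neg.upperSemicontinuous
  have heq : M.bellmanGap h Λ = fun k => M.r k + M.L1adj Λ k + (-M.L0adj h) k :=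
    funext fun _ => sub_eq_add_neg _ _
  rw [heq]
  exact this

theorem L1adj_nonpos (Λ : FiniteMeasure M.Levels) (k : M.K) : M.L1adj Λ k ≤ 0 :=
  integral_nonpos fun _ => negPart_nonpos _

theorem bellmanGap_le (hM : M.Standing) (h : S →ᵇ ℝ) (Λ : FiniteMeasure M.Levels) (k : M.K) :
    M.bellmanGap h Λ k ≤ ‖h‖ + M.δ * ‖h‖ := by
  have h1 := neg_le_of_abs_le (h.norm_coe_le_norm k.1.1)
  have h2 := (le_abs_self _).trans (h.norm_integral_le_norm (M.Q k))
  have h3 := mul_le_mul_of_nonneg_left h2 M.δ_pos.le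
  have h4 := hM.r_nonpos k
  have h5 := L1adj_nonpos (M := M) Λ k
  simp only [bellmanGap, L0adj]
  linarith

theorem bellmanGap_zero_zero : M.bellmanGap 0 0 = M.r := by
  ext k
  simp [bellmanGap, L1adj, L0adj]

theorem L1adj_smul (c : NNReal) (Λ : FiniteMeasure M.Levels) (k : M.K) :
    M.L1adj (c • Λ) k = c * M.L1adj Λ k := by
  simp only [L1adj, FiniteMeasure.toMeasure_smul, integral_smul_nnreal_measure]
  rfl

theorem L1adj_sum {ι : Type*} (s : Finset ι) (c : ι → NNReal) (Λ : ι → FiniteMeasure M.Levels)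
    (k : M.K) : M.L1adj (∑ i ∈ s, c i • Λ i) k = ∑ i ∈ s, c i * M.L1adj (Λ i) k := by
  have hc : Continuous fun η : M.Levels => negPart (M.z k - η) :=
    continuous_negPart.comp (continuous_const.sub continuous_subtype_val)
  simp_rw [← L1adj_smul]
  simp only [L1adj, FiniteMeasure.toMeasure_sum]
  exact integral_finsetSum_measure fun i _ => integrable_continuous_levels hc _

theorem integral_y_sum {ι : Type*} (s : Finset ι) (c : ι → NNReal)
    (Λ : ι → FiniteMeasure M.Levels) :
    ∫ η : M.Levels, M.y η ∂((∑ i ∈ s, c i • Λ i : FiniteMeasure M.Levels) : Measure M.Levels)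
      = ∑ i ∈ s, c i * ∫ η : M.Levels, M.y η ∂(Λ i : Measure M.Levels) := by
  rw [FiniteMeasure.toMeasure_sum,
    integral_finsetSum_measure fun i _ => integrable_continuous_levels continuous_y _]
  refine Finset.sum_congr rfl fun i _ => ?_
  rw [FiniteMeasure.toMeasure_smul, integral_smul_nnreal_measure]
  rfl

theorem nonempty_K (M : Model S A Ω) : Nonempty M.K := by
  obtain ⟨s⟩ := nonempty_of_isProbabilityMeasure M.ν
  obtain ⟨a, ha⟩ := M.K_nonempty s
  exact ⟨⟨(s, a), ha⟩⟩

/-- A convex combination of multipliers whose Lagrangian bounds are jointly unattainable is, after a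
shift of `h` by a constant, feasible for the dual problem. -/
theorem exists_dualFeasible_lt (hM : M.Standing) {ι : Type*} [Fintype ι] (h : ι → S →ᵇ ℝ)
    (Λ : ι → FiniteMeasure M.Levels) (β : ι → ℝ) {v : ℝ} (hβ : ∀ i, β i < v)
    (H : ∀ p : Measure M.K, IsProbabilityMeasure p →
      (∀ i, Integrable (M.bellmanGap (h i) (Λ i)) p) →
      ∃ i, ∫ k, M.bellmanGap (h i) (Λ i) k ∂p < (1 - M.δ) * (β i - M.dualObj (h i) (Λ i))) :
    ∃ x ∈ M.dualValues, x < v := by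
  have := nonempty_K M
  -- The constants are moved inside the integrals, which is harmless for probability measures.
  obtain ⟨l, hl0, hl1, hl⟩ := exists_weights_of_forall_exists_integral_neg
    (f := fun i k => M.bellmanGap (h i) (Λ i) k
      - (1 - M.δ) * (β i - M.dualObj (h i) (Λ i))) (fun p hp hpi => by
    have hpi' : ∀ i, Integrable (M.bellmanGap (h i) (Λ i)) p := fun i => by
      refine ((hpi i).add (integrable_const
        ((1 - M.δ) * (β i - M.dualObj (h i) (Λ i))))).congr (Eventually.of_forall fun k => ?_)
      simp
    obtain ⟨i, hi⟩ := H p hp hpi'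
    refine ⟨i, ?_⟩
    rw [integral_sub (hpi' i) (integrable_const _), integral_const, probReal_univ, one_smul]
    linarith)
  have hlt : ∑ i, l i * β i < v := by
    have hne : ∃ i ∈ Finset.univ, 0 < l i := by
      by_contra! hn
      have : ∑ i, l i ≤ 0 := Finset.sum_nonpos hn
      linarith
    calc ∑ i, l i * β i < ∑ i, l i * v := by
          obtain ⟨i, hi, hpos⟩ := hne
          exact Finset.sum_lt_sum (fun j _ => mul_le_mul_of_nonneg_left (hβ j).le (hl0 j))
            ⟨i, hi, mul_lt_mul_of_pos_left (hβ i) hpos⟩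
      _ = v := by rw [← Finset.sum_mul, hl1, one_mul]
  set D := ∑ i, l i * M.dualObj (h i) (Λ i) with hD
  -- Adding `t` to `h` raises `L₀* h` by `(1 - δ) t` and the dual objective by `t`. This choice
  -- makes the objective exactly `∑ i, l i * β i` and absorbs the constant in the combined
  -- inequality.
  set t := ∑ i, l i * β i - D with ht
  let h' : S → ℝ := fun s => ∑ i, l i * h i s + t
  let Λ' : FiniteMeasure M.Levels := ∑ i, (l i).toNNReal • Λ i
  have hint : ∀ (m : Measure S) [IsProbabilityMeasure m],
      ∫ s, h' s ∂m = ∑ i, l i * ∫ s, h i s ∂m + t := fun m _ => by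
    have hi : ∀ i ∈ Finset.univ, Integrable (fun s => l i * h i s) m := fun i _ =>
      ((h i).integrable m).const_mul _
    simp only [h']
    rw [integral_add (integrable_finsetSum _ hi) (integrable_const t), integral_finsetSum _ hi]
    simp [integral_const_mul]
  have hL1 : ∀ k, M.L1adj Λ' k = ∑ i, l i * M.L1adj (Λ i) k := fun k => by
    simp only [Λ', L1adj_sum, Real.coe_toNNReal _ (hl0 _)]
  have hL0 : ∀ k, M.L0adj h' k = ∑ i, l i * M.L0adj (h i) k + (1 - M.δ) * t := fun k => by
    rw [L0adj, hint]
    simp only [h', L0adj, mul_sub, Finset.sum_sub_distrib, mul_add, Finset.mul_sum]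
    simp_rw [mul_left_comm M.δ]
    ring
  have hobj : M.dualObj h' Λ' = ∑ i, l i * β i := by
    rw [dualObj, hint, integral_y_sum]
    simp only [Real.coe_toNNReal _ (hl0 _), ht, hD, dualObj, mul_sub, Finset.sum_sub_distrib]
    ring
  have hbdd : ∀ s, |h' s| ≤ ∑ i, l i * ‖h i‖ + |t| := fun s => by
    refine (abs_add_le _ _).trans (add_le_add_left ?_ _)
    refine (Finset.abs_sum_le_sum_abs _ _).trans (Finset.sum_le_sum fun i _ => ?_)
    rw [abs_mul, abs_of_nonneg (hl0 i)]
    exact mul_le_mul_of_nonneg_left ((h i).norm_coe_le_norm s) (hl0 i)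
  have hcont : Continuous h' := by fun_prop
  refine ⟨_, ⟨(h', Λ'), ⟨hM.mem_FwHat_of_bounded hcont.measurable hbdd, ?_⟩, rfl⟩, ?_⟩
  · refine bellmanIneq_iff.2 fun k => ?_
    have hk := hl k
    have hr : ∑ i, l i * M.r k = M.r k := by rw [← Finset.sum_mul, hl1, one_mul]
    have e1 : ∑ i, l i * (M.bellmanGap (h i) (Λ i) k
        - (1 - M.δ) * (β i - M.dualObj (h i) (Λ i)))
        = ∑ i, l i * M.r k + ∑ i, l i * M.L1adj (Λ i) k - ∑ i, l i * M.L0adj (h i) k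
          - (1 - M.δ) * (∑ i, l i * β i - D) := by
      simp only [hD, bellmanGap, mul_sub, mul_add, Finset.sum_sub_distrib, Finset.sum_add_distrib,
        Finset.mul_sum]
      simp_rw [mul_left_comm (1 - M.δ)]
    rw [bellmanGap, hL1, hL0]
    rw [e1, hr] at hk
    linarith
  · change M.dualObj h' Λ' < v
    rwa [hobj]

theorem nonpos_of_forall_mul_le {x c : ℝ} (h : ∀ t : ℝ, 0 ≤ t → t * x ≤ c) : x ≤ 0 := by
  by_contra! hx
  have := h ((|c| + 1) / x) (by positivity)
  rw [div_mul_cancel₀ _ hx.ne'] at this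
  linarith [le_abs_self c]

/-- With `δ μQ` moved to the side of `ν`, the equation compares two positive finite measures, which
are determined by bounded continuous test functions. -/
theorem L0_eq_of_forall_integral (hM : M.Standing) {μ : FiniteMeasure M.K} (hμ : μ ∈ M.MwPos)
    (H : ∀ h : S →ᵇ ℝ, ∫ k, M.L0adj h k ∂(μ : Measure M.K) = ∫ s, h s ∂M.ν) :
    M.L0 μ = M.ν.toSignedMeasure := by
  have hfst : Measurable fun k : M.K => k.1.1 := measurable_fst.comp measurable_subtype_coe
  have hm : (μ : Measure M.K).map (fun k => k.1.1)
      = M.ν + M.δ.toNNReal • (μ : Measure M.K).bind M.Q := by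
    refine ext_of_forall_integral_eq_of_IsFiniteMeasure fun h => ?_
    have hF := hM.bcf_mem_FwHat h
    have h1 := H h
    unfold L0adj at h1
    rw [integral_sub (integrable_fst_of_mem_FwHat hM hF hμ)
      ((integral_bind_of_mem_FwHat hM hF hμ).1.const_mul _), integral_const_mul,
      (integral_bind_of_mem_FwHat hM hF hμ).2] at h1
    rw [integral_map hfst.aemeasurable h.continuous.aestronglyMeasurable,
      integral_add_measure (h.integrable _) (h.integrable _), integral_smul_nnreal_measure,
      NNReal.smul_def, Real.coe_toNNReal _ M.δ_pos.le, smul_eq_mul]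
    linarith
  rw [L0]
  simp only [hm]
  rw [Measure.toSignedMeasure_add, Measure.toSignedMeasure_smul]
  ext B hB
  simp [NNReal.smul_def, Real.coe_toNNReal _ M.δ_pos.le]

/-- Every lower bound of the dual values is attained from above by a feasible point of the primal
problem. -/
theorem exists_primalFeasible_ge (hM : M.Standing) {v : ℝ} (hv : ∀ x ∈ M.dualValues, v ≤ x) :
    ∃ μ ∈ M.primalFeasible, v ≤ M.primalObj μ := by
  classical
  have he : 0 < 1 - M.δ := sub_pos.2 M.δ_lt_one
  -- Here `p` stands for `(1 - δ) μ`, and the condition says that the Lagrangian at `μ` is at least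
  -- `β`. The strict `β < v` leaves room for the contradiction.
  let T : {β : ℝ // β < v} × (S →ᵇ ℝ) × FiniteMeasure M.Levels → Set (ProbabilityMeasure M.K) :=
    fun i => {p | Integrable (M.bellmanGap i.2.1 i.2.2) (p : Measure M.K) ∧
      (1 - M.δ) * (i.1 - M.dualObj i.2.1 i.2.2)
        ≤ ∫ k, M.bellmanGap i.2.1 i.2.2 k ∂(p : Measure M.K)}
  have hTc : ∀ i, IsClosed (T i) := fun i =>
    isClosed_setOf_le_integral (upperSemicontinuous_bellmanGap hM i.2.1 i.2.2)
      (bellmanGap_le hM i.2.1 i.2.2) _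
  -- With zero multipliers the gap is `r` itself, so this set is compact; `v - 1` is an arbitrary
  -- number below `v`.
  let i₀ : {β : ℝ // β < v} × (S →ᵇ ℝ) × FiniteMeasure M.Levels := ⟨⟨v - 1, by linarith⟩, 0, 0⟩
  have hT₀ : IsCompact (T i₀) := by
    simp only [T, i₀, BoundedContinuousFunction.coe_zero, bellmanGap_zero_zero]
    exact isCompact_setOf_le_integral hM.r_usc hM.r_nonpos hM.r_compact _
  obtain ⟨p, hp⟩ : (T i₀ ∩ ⋂ i, T i).Nonempty := by
    rw [Set.nonempty_iff_ne_empty]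
    intro hempty
    obtain ⟨u, hu⟩ := hT₀.elim_finite_subfamily_closed T hTc hempty
    obtain ⟨x, hx, hxv⟩ := exists_dualFeasible_lt hM
      (ι := {i // i ∈ insert i₀ u}) (fun i => i.1.2.1) (fun i => i.1.2.2) (fun i => i.1.1)
      (fun i => i.1.1.2) (fun p hp hi => by
        by_contra! hcon
        have : (⟨p, hp⟩ : ProbabilityMeasure M.K) ∈ T i₀ ∩ ⋂ i ∈ u, T i :=
          ⟨⟨hi ⟨i₀, Finset.mem_insert_self _ _⟩, hcon ⟨i₀, Finset.mem_insert_self _ _⟩⟩,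
            Set.mem_iInter₂.2 fun i hiu => ⟨hi ⟨i, Finset.mem_insert_of_mem hiu⟩,
              hcon ⟨i, Finset.mem_insert_of_mem hiu⟩⟩⟩
        rw [hu] at this
        exact this)
    exact absurd (hv x hx) (not_le.2 hxv)
  have hpT : ∀ i, p ∈ T i := Set.mem_iInter.1 hp.2
  have hpr : Integrable M.r (p : Measure M.K) := by
    have := (hpT i₀).1
    simpa only [i₀, BoundedContinuousFunction.coe_zero, bellmanGap_zero_zero] using this
  have hpM : p.toFiniteMeasure ∈ M.MwPos := hM.mem_MwPos_iff.2 hpr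
  have hbound : ∀ (h : S →ᵇ ℝ) (Λ : FiniteMeasure M.Levels), (1 - M.δ) * (v - M.dualObj h Λ)
      ≤ ∫ k, M.r k ∂(p : Measure M.K) + ∫ k, M.L1adj Λ k ∂(p : Measure M.K)
        - ∫ k, M.L0adj h k ∂(p : Measure M.K) := fun h Λ => by
    have h1 := integral_bellmanGap hM (hM.bcf_mem_FwHat h) Λ hpM
    simp only [ProbabilityMeasure.toMeasure_comp_toFiniteMeasure_eq_toMeasure] at h1
    rw [← h1]
    -- Let `β` increase to `v`.
    have : ∀ β < v, β ≤ (∫ k, M.bellmanGap h Λ k ∂(p : Measure M.K)) / (1 - M.δ)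
        + M.dualObj h Λ := fun β hβ => by
      have := (hpT ⟨⟨β, hβ⟩, h, Λ⟩).2
      rw [← sub_le_iff_le_add, le_div_iff₀ he]
      linarith
    have := le_of_forall_lt_imp_le_of_dense this
    rw [← sub_le_iff_le_add, le_div_iff₀ he] at this
    linarith
  let c : NNReal := (1 - M.δ)⁻¹.toNNReal
  have hc : (c : ℝ) = (1 - M.δ)⁻¹ := Real.coe_toNNReal _ (inv_nonneg.2 he.le)
  let μ : FiniteMeasure M.K := c • p.toFiniteMeasure
  have hμi : ∀ f : M.K → ℝ, ∫ k, f k ∂(μ : Measure M.K) = (1 - M.δ)⁻¹ * ∫ k, f k ∂(p : Measure M.K) :=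
    fun f => by
      simp only [μ, FiniteMeasure.toMeasure_smul, integral_smul_nnreal_measure, NNReal.smul_def, hc,
        smul_eq_mul, ProbabilityMeasure.toMeasure_comp_toFiniteMeasure_eq_toMeasure]
  have hμM : μ ∈ M.MwPos := hM.mem_MwPos_iff.2 (by
    simp only [μ, FiniteMeasure.toMeasure_smul,
      ProbabilityMeasure.toMeasure_comp_toFiniteMeasure_eq_toMeasure]
    exact hpr.smul_measure_nnreal)
  refine ⟨μ, ⟨hμM, L0_eq_of_forall_integral hM hμM fun h => ?_, fun η hη => ?_⟩, ?_⟩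
  -- The multiplier `t • h` is allowed for `t` of either sign, so a linear function of `t` is
  -- bounded above on all of `ℝ` and its slope is zero.
  · have key : ∀ t : ℝ, t * (∫ k, M.L0adj h k ∂(p : Measure M.K) - (1 - M.δ) * ∫ s, h s ∂M.ν)
        ≤ ∫ k, M.r k ∂(p : Measure M.K) - (1 - M.δ) * v := fun t => by
      have h1 := hbound (t • h) 0
      have h2 : ∀ k, M.L0adj (t • h : S →ᵇ ℝ) k = t * M.L0adj h k := fun k => by
        simp only [L0adj, BoundedContinuousFunction.coe_smul, smul_eq_mul, integral_const_mul]
        ring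
      have h3 : M.dualObj (t • h : S →ᵇ ℝ) 0 = t * ∫ s, h s ∂M.ν := by
        simp [dualObj, integral_const_mul]
      have h4 : ∀ k, M.L1adj 0 k = 0 := fun k => by simp [L1adj]
      simp only [h2, h3, h4, integral_const_mul, integral_zero] at h1
      linarith
    have hle := nonpos_of_forall_mul_le fun t _ => key t
    have hge := nonpos_of_forall_mul_le (x := -(∫ k, M.L0adj h k ∂(p : Measure M.K)
      - (1 - M.δ) * ∫ s, h s ∂M.ν)) (c := ∫ k, M.r k ∂(p : Measure M.K) - (1 - M.δ) * v) fun t _ => by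
        rw [mul_neg, ← neg_mul]; exact key (-t)
    have heq : ∫ k, M.L0adj h k ∂(p : Measure M.K) = (1 - M.δ) * ∫ s, h s ∂M.ν := by linarith
    rw [hμi, heq, inv_mul_cancel_left₀ he.ne']
  -- Nonnegative multiples of the Dirac mass at `η` isolate the constraint at level `η`; only `t ≥
  -- 0` is allowed, hence an inequality.
  · have key : ∀ t : ℝ, 0 ≤ t → t * ((1 - M.δ) * M.y η
        - ∫ k, negPart (M.z k - η) ∂(p : Measure M.K))
        ≤ ∫ k, M.r k ∂(p : Measure M.K) - (1 - M.δ) * v := fun t ht => by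
      let d : FiniteMeasure M.Levels := ⟨Measure.dirac ⟨η, hη⟩, inferInstance⟩
      have h1 := hbound 0 (t.toNNReal • d)
      have h2 : ∀ k, M.L1adj (t.toNNReal • d) k = t * negPart (M.z k - η) := fun k => by
        rw [L1adj_smul, Real.coe_toNNReal _ ht, L1adj]
        change t * ∫ η' : M.Levels, negPart (M.z k - η') ∂Measure.dirac ⟨η, hη⟩ = _
        rw [integral_dirac]
      have h3 : M.dualObj (0 : S →ᵇ ℝ) (t.toNNReal • d) = -(t * M.y η) := by
        simp only [dualObj, BoundedContinuousFunction.coe_zero, Pi.zero_apply, integral_zero,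
          FiniteMeasure.toMeasure_smul, integral_smul_nnreal_measure, NNReal.smul_def,
          Real.coe_toNNReal _ ht, zero_sub, smul_eq_mul]
        change -(t * ∫ η' : M.Levels, M.y η' ∂Measure.dirac ⟨η, hη⟩) = _
        rw [integral_dirac]
      have h4 : ∀ k, M.L0adj (0 : S →ᵇ ℝ) k = 0 := fun k => by simp [L0adj]
      simp only [h2, h3, h4, integral_const_mul, integral_zero] at h1
      linarith
    have hle := nonpos_of_forall_mul_le key
    rw [L1, hμi, ← div_eq_inv_mul, le_div_iff₀ he]
    linarith
  · have h1 := hbound 0 0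
    have h2 : ∀ k, M.L0adj (0 : S →ᵇ ℝ) k = 0 := fun k => by simp [L0adj]
    have h3 : M.dualObj (0 : S →ᵇ ℝ) 0 = 0 := by simp [dualObj]
    have h4 : ∀ k, M.L1adj 0 k = 0 := fun k => by simp [L1adj]
    simp only [h2, h3, h4, integral_zero] at h1
    rw [primalObj, hμi, ← div_eq_inv_mul, le_div_iff₀ he]
    linarith

/-- Integrate the Bellman inequality against `μ`, replace the `L₀` pairing by `⟨h, ν⟩`, and
integrate `y ≤ L₁ μ` against `Λ ≥ 0`. -/
theorem primalObj_le_dualObj (hM : M.Standing) {μ : FiniteMeasure M.K} (hμ : μ ∈ M.primalFeasible)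
    {h : S → ℝ} {Λ : FiniteMeasure M.Levels} (hd : (h, Λ) ∈ M.dualFeasible) :
    M.primalObj μ ≤ M.dualObj h Λ := by
  obtain ⟨hμM, hL0, hL1⟩ := hμ
  obtain ⟨hh, hB⟩ := hd
  have h1 := integral_nonpos (μ := (μ : Measure M.K)) (bellmanIneq_iff.1 hB)
  rw [integral_bellmanGap hM hh Λ hμM, ← integral_L1 hM] at h1
  have h2 := integral_L0_sub hM hh hμM
  rw [hL0, sub_self, VectorMeasure.integral_zero_vectorMeasure] at h2
  have h3 : ∫ η : M.Levels, M.y η ∂(Λ : Measure M.Levels)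
      ≤ ∫ η : M.Levels, M.L1 μ η ∂(Λ : Measure M.Levels) :=
    integral_mono (integrable_continuous_levels continuous_y Λ) (integrable_L1 hM μ Λ)
      fun η => hL1 η η.2
  rw [primalObj, dualObj]
  linarith

theorem zero_mem_dualFeasible (hM : M.Standing) :
    ((0 : S → ℝ), (0 : FiniteMeasure M.Levels)) ∈ M.dualFeasible := by
  refine ⟨hM.bcf_mem_FwHat 0, bellmanIneq_iff.2 fun k => ?_⟩
  change M.bellmanGap 0 0 k ≤ 0
  rw [bellmanGap_zero_zero]
  exact hM.r_nonpos k

/-- The real `sInf` is a genuine infimum here: the zero multipliers are feasible because `r ≤ 0`,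
and any feasible `μ` gives a lower bound. -/
theorem isGLB_dualValues (hM : M.Standing) : IsGLB M.dualValues (sInf M.dualValues) := by
  refine isGLB_csInf ⟨_, _, zero_mem_dualFeasible hM, rfl⟩ ?_
  obtain ⟨μ, hμ⟩ := hM.consistent
  refine ⟨M.primalObj μ, ?_⟩
  rintro _ ⟨q, hq, rfl⟩
  exact primalObj_le_dualObj hM hμ hq

/-- Strong duality, with attainment in the primal problem. -/
theorem isGreatest_primalValues (hM : M.Standing) :
    IsGreatest M.primalValues (sInf M.dualValues) := by
  have hglb := isGLB_dualValues hM
  have hle : ∀ μ ∈ M.primalFeasible, M.primalObj μ ≤ sInf M.dualValues := fun μ hμ =>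
    hglb.2 (by rintro _ ⟨q, hq, rfl⟩; exact primalObj_le_dualObj hM hμ hq)
  obtain ⟨μ, hμ, hμv⟩ := exists_primalFeasible_ge hM fun x hx => hglb.1 hx
  exact ⟨⟨μ, hμ, le_antisymm (hle μ hμ) hμv⟩, by rintro _ ⟨μ', hμ', rfl⟩; exact hle μ' hμ'⟩

end Duality

end Model

/-! ### Weak limits of measures and lower limits of functions -/

/-- A sequence of finite measures on a compact metrizable space with bounded masses has a weakly
convergent subsequence. -/
theorem exists_tendsto_integral_subseq {X : Type*} [TopologicalSpace X]
    [TopologicalSpace.MetrizableSpace X] [CompactSpace X] [Nonempty X] [MeasurableSpace X]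
    [BorelSpace X] (Λ : ℕ → FiniteMeasure X) {C : NNReal} (hC : ∀ n, (Λ n).mass ≤ C) :
    ∃ (Λ' : FiniteMeasure X) (φ : ℕ → ℕ), StrictMono φ ∧ ∀ f : X → ℝ, Continuous f →
      Tendsto (fun n => ∫ x, f x ∂(Λ (φ n) : Measure X)) atTop (𝓝 (∫ x, f x ∂(Λ' : Measure X))) := by
  -- Each measure is its mass times a probability measure, and both factors range over compact sets;
  -- a zero mass is harmless, as the product is still right.
  obtain ⟨⟨m, P⟩, -, φ, hφ, hlim⟩ :=
    (isCompact_Icc.prod isCompact_univ : IsCompact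
      (Set.Icc (0 : NNReal) C ×ˢ (Set.univ : Set (ProbabilityMeasure X)))).tendsto_subseq
      (x := fun n => ((Λ n).mass, (Λ n).normalize)) fun n => ⟨⟨zero_le, hC n⟩, trivial⟩
  rw [nhds_prod_eq, tendsto_prod_iff'] at hlim
  have hint : ∀ (m : NNReal) (P : ProbabilityMeasure X) (f : X → ℝ),
      ∫ x, f x ∂((m • P.toFiniteMeasure : FiniteMeasure X) : Measure X)
        = m * ∫ x, f x ∂(P : Measure X) := fun m P f => by
    rw [FiniteMeasure.toMeasure_smul, integral_smul_nnreal_measure]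
    rfl
  refine ⟨m • P.toFiniteMeasure, φ, hφ, fun f hf => ?_⟩
  have h1 := (NNReal.tendsto_coe.2 hlim.1).mul
    (ProbabilityMeasure.tendsto_iff_forall_integral_tendsto.1 hlim.2
      (BoundedContinuousFunction.mkOfCompact ⟨f, hf⟩))
  rw [hint]
  refine h1.congr fun n => ?_
  conv_rhs => rw [(Λ (φ n)).self_eq_mass_smul_normalize, hint]
  rfl

section LowerEnvelope

variable {X : Type*} [MeasurableSpace X] {f : ℕ → X → ℝ} {F : X → ℝ}

/-- The infimum of the tail of a sequence of functions. -/
def tailInf (f : ℕ → X → ℝ) (n : ℕ) (x : X) : ℝ := ⨅ m, f (n + m) x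

/-- The lower limit of a sequence of functions. -/
def lowerLimit (f : ℕ → X → ℝ) (x : X) : ℝ := ⨆ n, tailInf f n x

theorem bddBelow_tail (hF : ∀ n x, |f n x| ≤ F x) (n : ℕ) (x : X) :
    BddBelow (Set.range fun m => f (n + m) x) :=
  ⟨-F x, by rintro _ ⟨m, rfl⟩; exact neg_le_of_abs_le (hF _ x)⟩

theorem tailInf_le (hF : ∀ n x, |f n x| ≤ F x) (n m : ℕ) (x : X) : tailInf f n x ≤ f (n + m) x :=
  ciInf_le (bddBelow_tail hF n x) m

theorem abs_tailInf_le (hF : ∀ n x, |f n x| ≤ F x) (n : ℕ) (x : X) : |tailInf f n x| ≤ F x :=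
  abs_le.2 ⟨le_ciInf fun _ => neg_le_of_abs_le (hF _ x),
    (tailInf_le hF n 0 x).trans (le_of_abs_le (hF _ x))⟩

theorem measurable_tailInf (hf : ∀ n, Measurable (f n)) (n : ℕ) : Measurable (tailInf f n) :=
  Measurable.iInf fun _ => hf _

theorem measurable_lowerLimit (hf : ∀ n, Measurable (f n)) : Measurable (lowerLimit f) :=
  Measurable.iSup fun n => measurable_tailInf hf n

theorem tendsto_tailInf (hF : ∀ n x, |f n x| ≤ F x) (x : X) :
    Tendsto (fun n => tailInf f n x) atTop (𝓝 (lowerLimit f x)) := by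
  refine tendsto_atTop_ciSup (fun n n' hn => le_ciInf fun m => ?_)
    ⟨F x, by rintro _ ⟨n, rfl⟩; exact le_of_abs_le (abs_tailInf_le hF n x)⟩
  have := tailInf_le hF n (n' - n + m) x
  rwa [← add_assoc, Nat.add_sub_cancel' hn] at this

theorem abs_lowerLimit_le (hF : ∀ n x, |f n x| ≤ F x) (x : X) : |lowerLimit f x| ≤ F x :=
  le_of_tendsto (tendsto_tailInf hF x).abs (Eventually.of_forall fun n => abs_tailInf_le hF n x)

theorem integrable_tailInf (hf : ∀ n, Measurable (f n)) (hF : ∀ n x, |f n x| ≤ F x)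
    {m : Measure X} (hm : Integrable F m) (n : ℕ) : Integrable (tailInf f n) m :=
  Integrable.mono' hm (measurable_tailInf hf n).aestronglyMeasurable
    (Eventually.of_forall fun x => abs_tailInf_le hF n x)

theorem tendsto_integral_tailInf (hf : ∀ n, Measurable (f n)) (hF : ∀ n x, |f n x| ≤ F x)
    {m : Measure X} (hm : Integrable F m) :
    Tendsto (fun n => ∫ x, tailInf f n x ∂m) atTop (𝓝 (∫ x, lowerLimit f x ∂m)) :=
  tendsto_integral_of_dominated_convergence F
    (fun n => (measurable_tailInf hf n).aestronglyMeasurable) hm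
    (fun n => Eventually.of_forall fun x => abs_tailInf_le hF n x)
    (Eventually.of_forall fun x => tendsto_tailInf hF x)

theorem integral_tailInf_le (hf : ∀ n, Measurable (f n)) (hF : ∀ n x, |f n x| ≤ F x)
    {m : Measure X} (hm : Integrable F m) (n i : ℕ) :
    ∫ x, tailInf f n x ∂m ≤ ∫ x, f (n + i) x ∂m :=
  integral_mono (integrable_tailInf hf hF hm n)
    (Integrable.mono' hm (hf _).aestronglyMeasurable (Eventually.of_forall fun x => hF _ x))
    fun x => tailInf_le hF n i x

end LowerEnvelope

/-! ### Attainment in the dual problem -/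

namespace Model

variable {S A Ω : Type*}
    [TopologicalSpace S] [TopologicalSpace.MetrizableSpace S] [SecondCountableTopology S]
    [MeasurableSpace S] [BorelSpace S]
    [TopologicalSpace A] [TopologicalSpace.MetrizableSpace A] [SecondCountableTopology A]
    [MeasurableSpace A] [BorelSpace A]
    [MeasurableSpace Ω]
    {M : Model S A Ω}

theorem nonempty_levels (M : Model S A Ω) : Nonempty M.Levels := by
  obtain ⟨ω, hω⟩ := M.Y_mem.exists
  exact ⟨⟨_, hω⟩⟩

/-- The `hₙ` need not converge pointwise along any subsequence. Their lower limit suffices: it is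
measurable, keeps the bound `C ŵ`, and the Bellman inequality bounds `hₙ` from below by a quantity
monotone in `hₙ`. -/
theorem exists_isLeast_dualValues (hM : M.Standing) (hseq : M.HasBoundedMinimizingSequence) :
    ∃ p ∈ M.dualFeasible, IsLeast M.dualValues (M.dualObj p.1 p.2) := by
  obtain ⟨h₀, Λ₀, hfeas₀, hobj₀, ⟨C, hC₀⟩, hΛ₀⟩ := hseq
  have := nonempty_levels M
  -- Weak* boundedness tested on the constant `1` bounds the masses.
  obtain ⟨D, hD⟩ := hΛ₀ 1
  obtain ⟨Λ', φ, hφ, hlim⟩ := exists_tendsto_integral_subseq Λ₀ (C := D.toNNReal) fun n => by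
    have h1 := (le_abs_self _).trans (hD n)
    simp only [ContinuousMap.one_apply, integral_const, smul_eq_mul, mul_one] at h1
    exact NNReal.le_toNNReal_of_coe_le h1
  set h : ℕ → S → ℝ := fun n => h₀ (φ n)
  set Λ : ℕ → FiniteMeasure M.Levels := fun n => Λ₀ (φ n)
  have hfeas : ∀ n, (h n, Λ n) ∈ M.dualFeasible := fun n => hfeas₀ (φ n)
  have hobj : Tendsto (fun n => M.dualObj (h n) (Λ n)) atTop (𝓝 (sInf M.dualValues)) :=
    hobj₀.comp hφ.tendsto_atTop
  have hC : ∀ n s, |h n s| ≤ C * M.wHat s := fun n => hC₀ (φ n)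
  have hmeas : ∀ n, Measurable (h n) := fun n => (hfeas n).1.1
  have hmem : lowerLimit h ∈ M.FwHat := ⟨measurable_lowerLimit hmeas, C, abs_lowerLimit_le hC⟩
  have hL1 : ∀ k, Tendsto (fun n => M.L1adj (Λ n) k) atTop (𝓝 (M.L1adj Λ' k)) := fun k =>
    hlim _ (continuous_negPart.comp (continuous_const.sub continuous_subtype_val))
  have hy := hlim _ (continuous_y (M := M))
  have hQ : ∀ k, Integrable (fun s => C * M.wHat s) (M.Q k) := fun k => by
    obtain ⟨_, hE⟩ := hM.exists_integral_wHat_le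
    exact (hE k).1.const_mul C
  have hbell : M.BellmanIneq (lowerLimit h) Λ' := by
    intro k
    refine le_of_forall_pos_le_add fun ε hε => ?_
    -- The slack `ε` replaces `Λ (n + m)` by `Λ'`, and the tail infimum replaces `h (n + m)` under
    -- `Q`. The lower bound is then independent of `m` and passes to the infimum on the right.
    have hev : ∀ᶠ n in atTop, M.r k + M.L1adj Λ' k - ε + M.δ * ∫ ξ, tailInf h n ξ ∂(M.Q k)
        ≤ tailInf h n k.1.1 := by
      obtain ⟨N, hN⟩ := eventually_atTop.1 ((hL1 k).eventually_const_le
        (show M.L1adj Λ' k - ε < M.L1adj Λ' k by linarith))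
      filter_upwards [eventually_ge_atTop N] with n hn
      refine le_ciInf fun m => ?_
      have h1 := (hfeas (n + m)).2 k
      have h2 := hN (n + m) (hn.trans (Nat.le_add_right n m))
      have h3 := mul_le_mul_of_nonneg_left
        (integral_tailInf_le hmeas hC (hQ k) n m) M.δ_pos.le
      unfold L0adj at h1
      linarith
    have := le_of_tendsto_of_tendsto (((tendsto_integral_tailInf hmeas hC (hQ k)).const_mul
      M.δ).const_add (M.r k + M.L1adj Λ' k - ε)) (tendsto_tailInf hC k.1.1) hev
    unfold L0adj
    linarith
  have hle : M.dualObj (lowerLimit h) Λ' ≤ sInf M.dualValues := by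
    have hν : Integrable (fun s => C * M.wHat s) M.ν := hM.integrable_wHat_nu.const_mul C
    refine le_of_tendsto_of_tendsto' ((tendsto_integral_tailInf hmeas hC hν).sub hy) hobj fun n => ?_
    exact sub_le_sub_right (integral_tailInf_le hmeas hC hν n 0) _
  refine ⟨(lowerLimit h, Λ'), ⟨hmem, hbell⟩, ⟨_, ⟨hmem, hbell⟩, rfl⟩, fun x hx => ?_⟩
  exact hle.trans ((isGLB_dualValues hM).1 hx)

end Model

end

end DominanceMDP

theorem mainTheorem8 {S A Ω : Type*}
    [TopologicalSpace S] [TopologicalSpace.MetrizableSpace S] [SecondCountableTopology S]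
    [MeasurableSpace S] [BorelSpace S] [StandardBorelSpace S]
    [TopologicalSpace A] [TopologicalSpace.MetrizableSpace A] [SecondCountableTopology A]
    [MeasurableSpace A] [BorelSpace A] [StandardBorelSpace A]
    [MeasurableSpace Ω]
    (M : DominanceMDP.Model S A Ω) (hM : M.Standing) :
    -- The Lagrangian dual function; the free multiplier of the equation is written as `-h`.
    (∀ h ∈ M.FwHat, ∀ Λ : FiniteMeasure M.Levels,
      (M.BellmanIneq h Λ →
        (⨆ μ ∈ M.MwPos, ((M.lagrangian μ (-h) Λ : ℝ) : EReal)) = ((M.dualObj h Λ : ℝ) : EReal)) ∧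
      (¬ M.BellmanIneq h Λ →
        (⨆ μ ∈ M.MwPos, ((M.lagrangian μ (-h) Λ : ℝ) : EReal)) = ⊤)) ∧
    -- The optimal values are equal, and the primal maximum is attained.
    (∃ v : ℝ, IsGreatest M.primalValues v ∧ IsGLB M.dualValues v) ∧
    -- The dual problem is solvable.
    (M.HasBoundedMinimizingSequence →
      ∃ p ∈ M.dualFeasible, IsLeast M.dualValues (M.dualObj p.1 p.2)) := by
  refine ⟨fun h hh Λ => ⟨DominanceMDP.Model.iSup_lagrangian_of_bellmanIneq hM hh Λ,
    DominanceMDP.Model.iSup_lagrangian_of_not_bellmanIneq hM hh Λ⟩,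
    ⟨_, DominanceMDP.Model.isGreatest_primalValues hM, DominanceMDP.Model.isGLB_dualValues hM⟩,
    DominanceMDP.Model.exists_isLeast_dualValues hM⟩
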